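/- Let $I_{22,2}=\langle 1\rangle^{22}\oplus\langle -1\rangle^{2}$, and let $h,\pi\in I_{22,2}$ be vectors with $h\cdot h=15$, $h\cdot\pi=7$, $\pi\cdot\pi=4$, such that the orthogonal complement $\Lambda_{11}^{\perp}\subset I_{22,2}$ of the sublattice $\Lambda_{11}:=\mathbb{Z}h+\mathbb{Z}\pi$ is an even lattice. Let $\widetilde{\mathrm O}=\{g\in \mathrm O(I_{22,2}) : g|_{\Lambda_{11}}=\mathrm{id}\}$. For an integer $d$, let $\mathcal O_d$ be the set of orbits of $\widetilde{\mathrm O}$ on the set of primitive (i.e. saturated), positive definite sublattices $M_d\subset I_{22,2}$ of rank $3$ and discriminant $d$ that contain $\Lambda_{11}$. Then for every integer $d>0$ with $d\equiv 0,2,6,8,10$ or $18 \bmod 22$, the set $\mathcal O_d$ consists of exactly one element, and it is represented by a sublattice $M_d$ that has a $\mathbb Z$-basis with first two vectors $h,\pi$ and with Gram matrix $$\begin{pmatrix}15&7&a\\7&4&b\\a&b&c\end{pmatrix},$$ where (a) $(a,b,c)=(0,0,d/11)$ if $d\equiv 0\bmod 22$; (b) $(a,b,c)=(3,1,(d+9)/11)$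 if $d\equiv 2\bmod 22$; (c) $(a,b,c)=(1,1,(d+5)/11)$ if $d\equiv 6\bmod 22$; (d) $(a,b,c)=(2,1,(d+3)/11)$ if $d\equiv 8\bmod 22$; (e) $(a,b,c)=(3,2,(d+12)/11)$ if $d\equiv 10\bmod 22$; (f) $(a,b,c)=(1,0,(d+4)/11)$ if $d\equiv 18\bmod 22$. -/

import Mathlib

open scoped Pointwise

/-- The underlying group of the lattice `I_{22,2}`: free of rank `24`. -/
abbrev I222 : Type := Fin 22 ⊕ Fin 2 → ℤ

/-- The bilinear form of `I_{22,2} = ⟨1⟩^22 ⊕ ⟨-1⟩^2`. -/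
def I222.form : LinearMap.BilinForm ℤ I222 :=
  Matrix.toBilin' (Matrix.diagonal (Sum.elim (fun _ : Fin 22 => (1 : ℤ)) (fun _ : Fin 2 => -1)))

/-- The group of isometries of `I_{22,2}` that restrict to the identity on the sublattice `L`. -/
def isometriesFixing (L : Submodule ℤ I222) : Subgroup (I222 ≃ₗ[ℤ] I222) where
  carrier := {g | (∀ x y, I222.form (g x) (g y) = I222.form x y) ∧ ∀ x ∈ L, g x = x}
  mul_mem' := by
    rintro a b ⟨ha, ha'⟩ ⟨hb, hb'⟩
    refine ⟨fun x y => ?_, fun x hx => ?_⟩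
    · rw [LinearEquiv.mul_apply, LinearEquiv.mul_apply, ha, hb]
    · rw [LinearEquiv.mul_apply, hb' x hx, ha' x hx]
  one_mem' := ⟨fun _ _ => rfl, fun _ _ => rfl⟩
  inv_mem' := by
    rintro a ⟨ha, ha'⟩
    have key : ∀ x, a (a⁻¹ x) = x := fun x => a.apply_symm_apply x
    refine ⟨fun x y => ?_, fun x hx => ?_⟩
    · rw [← ha, key, key]
    · apply a.injective
      rw [key, ha' x hx]

/-- A sublattice `M` is primitive (saturated) if the quotient by it is torsion-free. -/
def IsPrimitiveSublattice (M : Submodule ℤ I222) : Prop :=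
  ∀ (n : ℤ) (x : I222), n ≠ 0 → n • x ∈ M → x ∈ M

/-- The form is positive definite on the sublattice `M`. -/
def IsPositiveDefinite (M : Submodule ℤ I222) : Prop :=
  ∀ x ∈ M, x ≠ 0 → 0 < I222.form x x

/-- The Gram matrix of a basis of a sublattice `M`. -/
noncomputable def gramMatrix {M : Submodule ℤ I222} {r : ℕ} (b : Module.Basis (Fin r) ℤ M) :
    Matrix (Fin r) (Fin r) ℤ :=
  Matrix.of fun i j => I222.form (b i) (b j)

/-- `M` has rank `r`, and the determinant of its Gram matrix (which is the same for all bases)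
is `d`. -/
def HasRankAndDiscriminant (M : Submodule ℤ I222) (r : ℕ) (d : ℤ) : Prop :=
  ∃ b : Module.Basis (Fin r) ℤ M, (gramMatrix b).det = d

/-- The primitive, positive definite sublattices `M` of rank `3` and discriminant `d` that
contain `L`. -/
structure IsMarking (L : Submodule ℤ I222) (d : ℤ) (M : Submodule ℤ I222) : Prop where
  le : L ≤ M
  primitive : IsPrimitiveSublattice M
  posDef : IsPositiveDefinite M
  disc : HasRankAndDiscriminant M 3 d

/-- The set of markings of discriminant `d`, with the action `g • M = g(M)` of the isometries of
`I_{22,2}` that fix `L`. -/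
def markings (L : Submodule ℤ I222) (d : ℤ) :
    SubMulAction (isometriesFixing L) (Submodule ℤ I222) where
  carrier := {M | IsMarking L d M}
  smul_mem' := by
    rintro ⟨g, hg, hgL⟩ M ⟨hle, hprim, hpos, b, hb⟩
    have hmem : ∀ x, x ∈ g • M ↔ ∃ y ∈ M, g y = x := fun x => Iff.rfl
    change IsMarking L d (g • M)
    refine ⟨fun x hx => (hmem x).2 ⟨x, hle hx, hgL x hx⟩, fun n x hn hx => ?_, fun x hx h0 => ?_,
      b.map (g.submoduleMap M), ?_⟩
    · obtain ⟨y, hy, hyx⟩ := (hmem _).1 hx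
      refine (hmem _).2 ⟨g.symm x, hprim n _ hn ?_, g.apply_symm_apply x⟩
      rwa [← map_smul, ← hyx, g.symm_apply_apply]
    · obtain ⟨y, hy, rfl⟩ := (hmem _).1 hx
      rw [hg]
      exact hpos y hy (fun h => h0 (by rw [h, map_zero]))
    · rw [← hb]
      congr 1
      ext i j
      exact hg (b i) (b j)

/-- The set `O_d` of orbits of the isometries of `I_{22,2}` that fix `L` on the set of markings
of discriminant `d`. -/
abbrev MarkingOrbits (L : Submodule ℤ I222) (d : ℤ) : Type :=
  MulAction.orbitRel.Quotient (isometriesFixing L) (markings L d)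

/-- In a suitable basis whose first two vectors are `h` and `p`, the Gram matrix of `M` is `G`. -/
def HasGramMatrixExtending (h p : I222) (M : Submodule ℤ I222) (G : Matrix (Fin 3) (Fin 3) ℤ) :
    Prop :=
  ∃ b : Module.Basis (Fin 3) ℤ M, (b 0 : I222) = h ∧ (b 1 : I222) = p ∧ gramMatrix b = G

/-! A marking is `⟨h, p, u⟩`; put `a = h·u`, `b = p·u`, `c = u·u`. Its discriminant is `11c -
q(a,b)` with `q = 4a² - 14ab + 15b²`, and `4q = (4a - 7b)² + 11b²`. Replacing `u` by `±u + ih + jp`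
changes the sign of `(a,b)` and shifts it by the lattice generated by `(15,7)` and `(7,4)`, of index
11, whose cosets are told apart by `4a - 7b` mod 11. As `4d ≡ -(4a - 7b)²` mod 11, `d` determines
this coset up to sign. So `(a,b)` can be brought to any prescribed pair compatible with `d`, and `c`
is then forced (`exists_sign`, `exists_normalized`).

Primitivity of `⟨h, p, u⟩` means that `u` pairs onto `ℤ` with `⟨h, p⟩^⊥`. That complement contains
two orthogonal hyperbolic planes (`exists_two_hyperbolic`), so Eichler's criterion
(`exists_isometry`) makes vectors `u` with equal `(a,b,c)` conjugate under isometries fixing `h` and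
`p`. This gives uniqueness of the orbit.

For existence, evenness of the complement amounts to `x·x ≡ p·x` mod 2, so the only constraint on
`(a,b,c)` is `c ≡ b` mod 2, that is, `d` even (`exists_vector`). -/

namespace I222

/-! ### The unimodular form, transvections and reflections. -/

lemma form_apply (x y : I222) :
    form x y = ∑ i, x (Sum.inl i) * y (Sum.inl i) - ∑ j, x (Sum.inr j) * y (Sum.inr j) := by
  simp [form, Matrix.toBilin'_apply', dotProduct, Matrix.mulVec_diagonal, Fintype.sum_sum_type,
    sub_eq_add_neg]

lemma form_comm (x y : I222) : form x y = form y x := by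
  simp only [form_apply, mul_comm]

lemma exists_eq_smul_of_dvd {m : ℤ} {x : I222} (hm : ∀ y, m ∣ form x y) : ∃ z, x = m • z := by
  have hc : ∀ i, m ∣ x i := by
    intro i
    have := hm (Pi.single i 1)
    rw [form_apply] at this
    rcases i with i | j
    · simpa [Pi.single_apply] using this
    · simpa [Pi.single_apply] using this
  choose z hz using hc
  exact ⟨z, funext fun i => by simpa using hz i⟩

/-- The content of a vector is a value of the form on it. -/
lemma exists_content (x : I222) : ∃ (m : ℤ) (z y : I222), x = m • z ∧ form x y = m := by
  obtain ⟨m, hm⟩ := (IsPrincipalIdealRing.principal (LinearMap.range (form x))).principal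
  have h1 : m ∈ LinearMap.range (form x) := by
    rw [hm]; exact Submodule.mem_span_singleton_self m
  obtain ⟨y, hy⟩ := h1
  obtain ⟨z, hz⟩ := exists_eq_smul_of_dvd (m := m) (x := x) fun w => by
    have : form x w ∈ LinearMap.range (form x) := ⟨w, rfl⟩
    rw [hm, Submodule.mem_span_singleton] at this
    obtain ⟨c, hc⟩ := this
    exact ⟨c, by rw [← hc, smul_eq_mul, mul_comm]⟩
  exact ⟨m, z, y, hz, hy⟩

lemma eq_zero_of_form_eq_zero {x : I222} (hx : ∀ y, form x y = 0) : x = 0 := by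
  obtain ⟨z, hz⟩ := exists_eq_smul_of_dvd (m := 0) (x := x) fun y => by simp [hx]
  simpa using hz

/-- The Eichler transvection of an isotropic vector `e` and a vector `a` orthogonal to it, of
norm `2 * m`. -/
lemma exists_transvection {L : Submodule ℤ I222} {e a : I222} {m : ℤ} (he : form e e = 0)
    (hea : form e a = 0) (ha : form a a = 2 * m) (heL : ∀ x ∈ L, form e x = 0)
    (haL : ∀ x ∈ L, form a x = 0) :
    ∃ g ∈ isometriesFixing L,
      ∀ x, g x = x - form a x • e + form e x • a - (m * form e x) • e := by
  have hae : form a e = 0 := by rw [form_comm, hea]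
  let t (s : ℤ) : I222 →ₗ[ℤ] I222 :=
    LinearMap.id - s • (form a).smulRight e + s • (form e).smulRight a
      - m • (form e).smulRight e
  have ht (s : ℤ) (x : I222) :
      t s x = x - (s * form a x) • e + (s * form e x) • a - (m * form e x) • e := by
    simp [t, mul_smul]
  have hinv (s : ℤ) (hs : s * s = 1) (x : I222) : t (-s) (t s x) = x := by
    simp only [ht, map_sub, map_add, map_smul, smul_eq_mul, he, hea, hae, ha]
    match_scalars <;> first | ring1 | linear_combination (2 * m * form e x) * hs
  let g : I222 ≃ₗ[ℤ] I222 := LinearEquiv.ofLinearMap (t 1) (t (-1))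
    (LinearMap.ext fun x => by simpa using hinv (-1) (by norm_num) x)
    (LinearMap.ext fun x => by simpa using hinv 1 (by norm_num) x)
  have hg (x : I222) : g x = x - form a x • e + form e x • a - (m * form e x) • e := by
    have := ht 1 x
    rwa [one_mul, one_mul] at this
  refine ⟨g, ⟨fun x y => ?_, fun x hx => ?_⟩, hg⟩
  · simp only [hg, map_sub, map_add, map_smul, LinearMap.sub_apply, LinearMap.add_apply,
      LinearMap.smul_apply, smul_eq_mul, he, hea, hae, ha, form_comm x e, form_comm x a]
    ring
  · simp [hg, heL x hx, haL x hx]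

/-- An integral similarity that is, up to a scalar, a product of reflections taking `x` to `y`. -/
lemma exists_similarity {x y : I222} (hxy : form x x = form y y) (hx : form x x ≠ 0) :
    ∃ (N : ℤ) (φ : I222 →ₗ[ℤ] I222), N ≠ 0 ∧ (∀ v w, form (φ v) (φ w) = N ^ 2 * form v w) ∧
      φ x = N • y ∧ ∀ z, form x z = 0 → form y z = 0 → φ z = N • z := by
  let r (v : I222) : I222 →ₗ[ℤ] I222 := form v v • LinearMap.id - 2 • (form v).smulRight v
  have hr (v w : I222) : r v w = form v v • w - (2 * form v w) • v := by
    simp [r, mul_smul]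
  have hsim (v w w' : I222) : form (r v w) (r v w') = form v v ^ 2 * form w w' := by
    simp only [hr, map_sub, map_smul, LinearMap.sub_apply, LinearMap.smul_apply, smul_eq_mul,
      form_comm w v]
    ring
  have hyx : form y x = form x y := form_comm y x
  -- The denominator-free reflection in `x - y` takes `x` to a multiple of `y`. If `x - y` is
  -- isotropic, then `x + y` has norm `4 (y·y) ≠ 0`; its reflection takes `x` to a multiple of `-y`,
  -- and the reflection in `y` corrects the sign.
  by_cases hd : form (x - y) (x - y) = 0
  · have hd' : form y y = form x y := by
      simp only [map_sub, LinearMap.sub_apply, hyx, hxy] at hd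
      linarith
    refine ⟨form y y * form (x + y) (x + y), r y ∘ₗ r (x + y), ?_, ?_, ?_, ?_⟩
    · simp only [map_add, LinearMap.add_apply, hyx, hxy, ← hd']
      rw [hxy] at hx
      exact mul_ne_zero hx (by omega)
    · intro v w
      simp only [LinearMap.comp_apply, hsim]
      ring
    · simp only [LinearMap.comp_apply, hr, map_add, map_sub, map_smul, LinearMap.add_apply, hyx,
        hxy, ← hd', smul_eq_mul]
      module
    · intro z h1 h2
      simp only [LinearMap.comp_apply, hr, map_add, map_sub, map_smul, LinearMap.add_apply, h1, h2]
      module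
  · refine ⟨form (x - y) (x - y), r (x - y), hd, hsim _, ?_, ?_⟩
    · simp only [hr, map_sub, LinearMap.sub_apply, hyx, hxy]
      module
    · intro z h1 h2
      simp only [hr, map_sub, LinearMap.sub_apply, h1, h2]
      module

/-! ### Arithmetic of the pair `h, p` and of its complement. -/

lemma prime_eleven : Prime (11 : ℤ) :=
  Int.prime_iff_natAbs_prime.2 (by norm_num)

/-- The vectors `h`, `p` span a lattice with Gram matrix `[[15, 7], [7, 4]]` and even orthogonal
complement. -/
structure IsElevenPair (h p : I222) : Prop where
  hh : form h h = 15
  hp : form h p = 7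
  pp : form p p = 4
  even : ∀ x, form h x = 0 → form p x = 0 → Even (form x x)

/-- The vectors `e`, `f` span a hyperbolic plane orthogonal to `h` and `p`. -/
structure IsHyperbolicPair (h p e f : I222) : Prop where
  he : form h e = 0
  pe : form p e = 0
  hf : form h f = 0
  pf : form p f = 0
  ee : form e e = 0
  ff : form f f = 0
  ef : form e f = 1

namespace IsElevenPair

variable {h p : I222}

/-- The content of the restriction to `⟨h, p⟩^⊥` of the pairing with a vector. -/
lemma exists_content_orthogonal {h' p' : I222} (hh' : form h h' = 1) (ph' : form p h' = 0)
    (hp' : form h p' = 0) (pp' : form p p' = 1) (u : I222) :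
    ∃ (m : ℤ) (z y : I222), u - form u h' • h - form u p' • p = m • z ∧
      form h y = 0 ∧ form p y = 0 ∧ form u y = m := by
  -- This vector pairs with any `y` as `u` pairs with the projection `y - (h·y)h' - (p·y)p'` to the
  -- complement, so its content is the one sought.
  obtain ⟨m, z, y, hz, hy⟩ := exists_content (u - form u h' • h - form u p' • p)
  refine ⟨m, z, y - form h y • h' - form p y • p', hz, ?_, ?_, ?_⟩
  · simp only [map_sub, map_smul, smul_eq_mul, hh', hp']; ring
  · simp only [map_sub, map_smul, smul_eq_mul, ph', pp']; ring
  · rw [← hy]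
    simp only [map_sub, map_smul, LinearMap.sub_apply, LinearMap.smul_apply, smul_eq_mul]
    ring

variable (H : IsElevenPair h p)
include H

lemma ph : form p h = 7 := by rw [form_comm, H.hp]

/-- Evenness is applied to 11 times the orthogonal projection of `x` to `⟨h, p⟩^⊥`. Its norm is `121
x·x - 11 q(h·x, p·x)`, congruent to `x·x - (p·x)²` mod 2. -/
lemma even_form_sub (x : I222) : Even (form x x - form p x) := by
  have hx := form_comm x h
  have px := form_comm x p
  have := H.even ((11 : ℤ) • x - (4 * form h x - 7 * form p x) • h
      - (-7 * form h x + 15 * form p x) • p)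
    (by simp only [map_sub, map_smul, smul_eq_mul, H.hh, H.hp]; ring)
    (by simp only [map_sub, map_smul, smul_eq_mul, H.ph, H.pp]; ring)
  simp only [map_sub, map_smul, LinearMap.sub_apply, LinearMap.smul_apply, smul_eq_mul, H.hh,
    H.hp, H.ph, H.pp, hx, px] at this
  obtain ⟨k, hk⟩ := this
  generalize form x x = X at *
  generalize form h x = a at *
  generalize form p x = b at *
  refine ⟨k - 60 * X + 22 * a ^ 2 - 77 * a * b + 82 * b ^ 2 + (b ^ 2 - b) / 2, ?_⟩
  have : 2 * ((b ^ 2 - b) / 2) = b ^ 2 - b := Int.mul_ediv_cancel' (by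
    rw [pow_two, ← even_iff_two_dvd]
    have := Int.even_mul_pred_self b
    rwa [mul_sub, mul_one] at this)
  linear_combination hk - this

/-- This is primitivity of `⟨h, p⟩` in a unimodular lattice. The only possible obstruction is at 11,
where it would force `4h - 7p` to be divisible by 11; but its norm 44 is not divisible by 121. -/
lemma exists_dual : ∃ h' p' : I222, form h h' = 1 ∧ form p h' = 0 ∧ form h p' = 0 ∧
    form p p' = 1 := by
  obtain ⟨m, z, y, hz, hy⟩ := exists_content ((4 : ℤ) • h - (7 : ℤ) • p)
  have h44 : m * (m * form z z) = 44 := by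
    have : form ((4 : ℤ) • h - (7 : ℤ) • p) ((4 : ℤ) • h - (7 : ℤ) • p) = 44 := by
      simp only [map_sub, map_smul, LinearMap.sub_apply, LinearMap.smul_apply, smul_eq_mul, H.hh,
        H.hp, H.ph, H.pp]
      norm_num
    rw [hz] at this
    simpa only [map_smul, LinearMap.smul_apply, smul_eq_mul] using this
  have hm : ∃ c d : ℤ, c * m + d * 11 = 1 := by
    have hcop : IsCoprime m 11 := by
      rw [isCoprime_comm, prime_eleven.coprime_iff_not_dvd]
      rintro ⟨n, rfl⟩
      have : (121 : ℤ) ∣ 44 := ⟨n * (n * form z z), by rw [← h44]; ring⟩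
      omega
    exact hcop
  obtain ⟨c, d, hcd⟩ := hm
  simp only [map_sub, map_smul, LinearMap.sub_apply, LinearMap.smul_apply, smul_eq_mul] at hy
  obtain ⟨x, hx⟩ : ∃ x, 4 * form h x - 7 * form p x = 1 := by
    refine ⟨c • y + d • h, ?_⟩
    simp only [map_add, map_smul, smul_eq_mul, H.hh, H.ph]
    linear_combination c * hy + hcd
  -- a vector with products `(2, 1)`
  obtain ⟨w, hw, pw⟩ : ∃ w, form h w = 2 ∧ form p w = 1 := by
    obtain ⟨n, hn⟩ : ∃ n, form p x = 1 + 4 * n := ⟨(form p x - 1) / 4, by omega⟩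
    refine ⟨x - n • p, ?_, ?_⟩
    · simp only [map_sub, map_smul, smul_eq_mul, H.hp]; omega
    · simp only [map_sub, map_smul, smul_eq_mul, H.pp]; omega
  refine ⟨h - (7 : ℤ) • w, w - (2 : ℤ) • (h - (7 : ℤ) • w), ?_, ?_, ?_, ?_⟩ <;>
  simp only [map_sub, map_smul, smul_eq_mul, H.hh, H.ph, hw, pw] <;> norm_num

/-- Every isotropic line in `⟨h, p⟩^⊥` lies in a hyperbolic plane. -/
lemma exists_hyperbolic {w : I222} (hw : form h w = 0) (pw : form p w = 0) (ww : form w w = 0)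
    (w0 : w ≠ 0) : ∃ (k : ℤ) (e f : I222), w = k • e ∧ k ≠ 0 ∧ IsHyperbolicPair h p e f := by
  obtain ⟨k, e, x, rfl, hk⟩ := exists_content w
  have hk0 : k ≠ 0 := by rintro rfl; simp at w0
  simp only [map_smul, LinearMap.smul_apply, smul_eq_mul, mul_eq_zero, hk0, false_or]
    at hw pw ww hk
  have hex : form e x = 1 := by
    refine mul_left_cancel₀ hk0 (by rw [hk, mul_one])
  have eh : form e h = 0 := by rw [form_comm, hw]
  have ep : form e p = 0 := by rw [form_comm, pw]
  obtain ⟨h', p', hh', ph', hp', pp'⟩ := H.exists_dual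
  obtain ⟨m, z, y, hz, hy, py, ey⟩ := exists_content_orthogonal hh' ph' hp' pp' e
  generalize form e h' = s at hz
  generalize form e p' = t at hz
  have h1 : -(15 * s + 7 * t) = m * form h z := by
    have := congrArg (form h) hz
    simp only [map_sub, map_smul, smul_eq_mul, H.hh, H.hp, hw] at this
    linear_combination this
  have h2 : -(7 * s + 4 * t) = m * form p z := by
    have := congrArg (form p) hz
    simp only [map_sub, map_smul, smul_eq_mul, H.ph, H.pp, pw] at this
    linear_combination this
  have h3 : 15 * s ^ 2 + 14 * s * t + 4 * t ^ 2 = m ^ 2 * form z z := by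
    have := congrArg (fun v => form v v) hz
    simp only [map_sub, map_smul, LinearMap.sub_apply, LinearMap.smul_apply, smul_eq_mul, H.hh,
      H.hp, H.ph, H.pp, hw, pw, ww, eh, ep] at this
    linear_combination this
  have h4 : 1 - s * form h x - t * form p x = m * form z x := by
    have := congrArg (fun v => form v x) hz
    simp only [map_sub, map_smul, LinearMap.sub_apply, LinearMap.smul_apply, smul_eq_mul,
      hex] at this
    linear_combination this
  -- By `h1` and `h2`, `m` divides the Gram matrix applied to `(s, t)`, hence divides `11s` and
  -- `11t`; `h4` then gives `m ∣ 11`.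
  have hm11 : m ∣ 11 := by
    refine ⟨11 * form z x + form h x * (- (4 * form h z) + 7 * form p z)
      + form p x * (7 * form h z - 15 * form p z), ?_⟩
    linear_combination 11 * h4 + (-4 * form h x + 7 * form p x) * h1
      + (7 * form h x - 15 * form p x) * h2
  have hm : m ^ 2 = 1 := by
    obtain hm | hm := (Nat.dvd_prime (by norm_num : Nat.Prime 11)).1 (Int.natAbs_dvd_natAbs.2 hm11)
    · rw [← Int.natAbs_sq, hm]; rfl
    -- The discriminant group of order 11 has no nonzero isotropic element: `m = ±11` would force
    -- `11 ∣ s` and `11 ∣ t`, contradicting `h4`.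
    exfalso
    have hm2 : m ^ 2 = 121 := by rw [← Int.natAbs_sq, hm]; rfl
    have h11 : (11 : ℤ) ∣ m := Int.natAbs_dvd_natAbs.1 (by rw [hm]; rfl)
    obtain ⟨i, hi⟩ : (11 : ℤ) ∣ 15 * s + 7 * t := by
      rw [← dvd_neg, h1]; exact h11.mul_right _
    obtain ⟨n, rfl⟩ : ∃ n, s = t + 11 * n := ⟨(s - t) / 11, by omega⟩
    have ht : (11 : ℤ) ∣ t := by
      refine prime_eleven.dvd_of_dvd_pow (n := 2) ?_
      have : (11 : ℤ) ∣ 3 * t ^ 2 :=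
        ⟨form z z - 15 * n ^ 2 - 4 * n * t, by rw [hm2] at h3; linarith⟩
      omega
    have : (11 : ℤ) ∣ 1 := by
      have : (1 : ℤ) = m * form z x + (t * form h x + t * form p x + 11 * (n * form h x)) := by
        linear_combination h4
      rw [this]
      exact dvd_add (h11.mul_right _) (dvd_add (dvd_add (ht.mul_right _) (ht.mul_right _))
        (dvd_mul_right _ _))
    omega
  -- Evenness of `y·y` makes the isotropic partner `m y - c e` of `e` integral.
  obtain ⟨c, hc⟩ := H.even y hy py
  have ye : form y e = m := by rw [form_comm, ey]
  refine ⟨k, e, m • y - c • e, rfl, hk0, hw, pw, ?_, ?_, ww, ?_, ?_⟩ <;>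
  simp only [map_sub, map_smul, LinearMap.sub_apply, LinearMap.smul_apply, smul_eq_mul,
      hy, hw, py, pw, ww, ey, ye, hc] <;> first | ring1 | linear_combination hm
end IsElevenPair

/-! ### Two orthogonal hyperbolic planes in the complement. -/

namespace IsElevenPair

variable {h p : I222} (H : IsElevenPair h p)
include H

/-- The orthogonal complement of `⟨h, p⟩` has Witt index two: it is similar over the integers
to the complement of a standard pair. -/
lemma exists_isotropic_plane : ∃ w₁ w₂ : I222, form h w₁ = 0 ∧ form p w₁ = 0 ∧ form h w₂ = 0 ∧
    form p w₂ = 0 ∧ form w₁ w₁ = 0 ∧ form w₁ w₂ = 0 ∧ form w₂ w₂ = 0 ∧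
    ∀ a b : ℤ, a • w₁ + b • w₂ = 0 → a = 0 ∧ b = 0 := by
  let v (f : Fin 22 → ℤ) (g : Fin 2 → ℤ) : I222 := Sum.elim f g
  -- The complement of this model pair need not be even: the comparison is Witt's extension theorem
  -- over `ℚ` with denominators cleared, so only the Gram matrix matters.
  let p₀ := v (fun i => if i < 4 then 1 else 0) 0
  let h₀ := v (fun i => if i = 0 then 3 else if i = 1 then 2 else if i < 4 then 1 else 0) 0
  let u₁ := v (Pi.single 4 1) (Pi.single 0 1)
  let u₂ := v (Pi.single 5 1) (Pi.single 1 1)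
  have hh₀ : form h₀ h₀ = 15 := by rw [form_apply]; decide
  have hp₀ : form h₀ p₀ = 7 := by rw [form_apply]; decide
  have pp₀ : form p₀ p₀ = 4 := by rw [form_apply]; decide
  have hu₁ : form h₀ u₁ = 0 := by rw [form_apply]; decide
  have pu₁ : form p₀ u₁ = 0 := by rw [form_apply]; decide
  have hu₂ : form h₀ u₂ = 0 := by rw [form_apply]; decide
  have pu₂ : form p₀ u₂ = 0 := by rw [form_apply]; decide
  have u₁₁ : form u₁ u₁ = 0 := by rw [form_apply]; decide
  have u₁₂ : form u₁ u₂ = 0 := by rw [form_apply]; decide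
  have u₂₂ : form u₂ u₂ = 0 := by rw [form_apply]; decide
  have ph₀ : form p₀ h₀ = 7 := by rw [form_comm, hp₀]
  obtain ⟨N, φ, hN, hφ, hφp, -⟩ :=
    exists_similarity (pp₀.trans H.pp.symm) (by rw [pp₀]; norm_num)
  -- The vector `4h - 7p` is orthogonal to `p`. Once `p₀` has gone to a multiple of `p`, moving the
  -- image of `4h₀ - 7p₀` to a multiple of `4h - 7p` preserves the line of `p`.
  have key : form (φ ((4 : ℤ) • h₀ - (7 : ℤ) • p₀)) (φ ((4 : ℤ) • h₀ - (7 : ℤ) • p₀)) =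
      form (N • ((4 : ℤ) • h - (7 : ℤ) • p)) (N • ((4 : ℤ) • h - (7 : ℤ) • p)) := by
    rw [hφ]
    simp only [map_sub, map_smul, LinearMap.sub_apply, LinearMap.smul_apply, smul_eq_mul,
      hh₀, hp₀, ph₀, pp₀, H.hh, H.hp, H.ph, H.pp]
    ring
  have key0 : form (φ ((4 : ℤ) • h₀ - (7 : ℤ) • p₀)) (φ ((4 : ℤ) • h₀ - (7 : ℤ) • p₀)) ≠ 0 := by
    rw [hφ]
    simp only [map_sub, map_smul, LinearMap.sub_apply, LinearMap.smul_apply, smul_eq_mul,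
      hh₀, hp₀, ph₀, pp₀]
    have := pow_ne_zero 2 hN
    omega
  obtain ⟨N', ψ, hN', hψ, hψh, hψp⟩ := exists_similarity key key0
  have hψp' : ψ p = N' • p := by
    refine hψp p (mul_left_cancel₀ hN ?_) ?_
    · rw [← smul_eq_mul, ← map_smul, ← hφp, hφ]
      simp only [map_sub, map_smul, LinearMap.sub_apply, LinearMap.smul_apply, smul_eq_mul,
        hp₀, pp₀]
      ring
    · simp only [map_sub, map_smul, LinearMap.sub_apply, LinearMap.smul_apply, smul_eq_mul,
        H.hp, H.pp]
      ring
  have hsim (x y : I222) : form (ψ (φ x)) (ψ (φ y)) = (N' * N) ^ 2 * form x y := by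
    rw [hψ, hφ]; ring
  have hNN : N' * N ≠ 0 := mul_ne_zero hN' hN
  have him : ψ (φ p₀) = (N' * N) • p := by
    rw [hφp, map_smul, hψp', smul_smul, mul_comm]
  have hperp (u : I222) (h1 : form h₀ u = 0) (h2 : form p₀ u = 0) :
      form h (ψ (φ u)) = 0 ∧ form p (ψ (φ u)) = 0 := by
    have hpu : form p (ψ (φ u)) = 0 := by
      refine mul_left_cancel₀ hNN ?_
      rw [← smul_eq_mul, ← LinearMap.smul_apply, ← map_smul, ← him, hsim, h2]
      ring
    refine ⟨?_, hpu⟩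
    have : form (N' • N • ((4 : ℤ) • h - (7 : ℤ) • p)) (ψ (φ u)) = 0 := by
      rw [← hψh, hsim]
      simp [-zsmul_eq_mul, h1, h2]
    simp only [map_sub, map_smul, LinearMap.sub_apply, LinearMap.smul_apply, smul_eq_mul, hpu,
      mul_eq_zero, hN, hN', false_or] at this
    omega
  refine ⟨ψ (φ u₁), ψ (φ u₂), (hperp u₁ hu₁ pu₁).1, (hperp u₁ hu₁ pu₁).2, (hperp u₂ hu₂ pu₂).1,
    (hperp u₂ hu₂ pu₂).2, by rw [hsim, u₁₁, mul_zero], by rw [hsim, u₁₂, mul_zero],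
    by rw [hsim, u₂₂, mul_zero], fun a b hab => ?_⟩
  have hz : a • u₁ + b • u₂ = 0 := by
    refine eq_zero_of_form_eq_zero fun x => mul_left_cancel₀ (pow_ne_zero 2 hNN) ?_
    rw [← hsim, map_add, map_add, map_smul, map_smul, map_smul, map_smul, hab]
    simp
  have h4 := congrFun hz (Sum.inl 4)
  have h5 := congrFun hz (Sum.inl 5)
  simp only [u₁, u₂, v, Pi.add_apply, Pi.smul_apply, Sum.elim_inl, Pi.zero_apply] at h4 h5
  rw [Pi.single_eq_same, Pi.single_eq_of_ne (by decide)] at h4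
  rw [Pi.single_eq_same, Pi.single_eq_of_ne (by decide)] at h5
  exact ⟨by simpa using h4, by simpa using h5⟩

lemma exists_two_hyperbolic : ∃ e f e' f' : I222, IsHyperbolicPair h p e f ∧
    IsHyperbolicPair h p e' f' ∧ form e e' = 0 ∧ form e f' = 0 ∧ form f e' = 0 ∧
    form f f' = 0 := by
  obtain ⟨w₁, w₂, hw₁, pw₁, hw₂, pw₂, w₁₁, w₁₂, w₂₂, hind⟩ := H.exists_isotropic_plane
  obtain ⟨k, e, f, rfl, hk, E⟩ := H.exists_hyperbolic hw₁ pw₁ w₁₁ (by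
    rintro rfl
    simpa using hind 1 0 (by simp))
  have ew₂ : form e w₂ = 0 := by simpa [-zsmul_eq_mul, hk] using w₁₂
  have we₂ : form w₂ e = 0 := by rw [form_comm, ew₂]
  have fe : form f e = 1 := by rw [form_comm, E.ef]
  obtain ⟨k', e', f₀, hk'e, hk', E'⟩ := H.exists_hyperbolic (w := w₂ - form f w₂ • e)
    (by simp [-zsmul_eq_mul, hw₂, E.he]) (by simp [-zsmul_eq_mul, pw₂, E.pe])
    (by simp only [map_sub, map_smul, LinearMap.sub_apply, LinearMap.smul_apply, smul_eq_mul,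
          w₂₂, ew₂, we₂, E.ee]; ring)
    (by
      intro h0
      have := (hind (- form f w₂) k (by
        rw [smul_smul, mul_comm, ← smul_smul, neg_smul, smul_neg, neg_add_eq_sub, ← smul_sub, h0,
          smul_zero])).2
      exact hk this)
  have ee' : form e e' = 0 := by
    refine mul_left_cancel₀ hk' ?_
    rw [← smul_eq_mul, ← map_smul, ← hk'e]
    simp [-zsmul_eq_mul, ew₂, E.ee]
  have fe' : form f e' = 0 := by
    refine mul_left_cancel₀ hk' ?_
    rw [← smul_eq_mul, ← map_smul, ← hk'e]
    simp [-zsmul_eq_mul, fe]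
  have e'e : form e' e = 0 := by rw [form_comm, ee']
  have e'f : form e' f = 0 := by rw [form_comm, fe']
  obtain ⟨c, hc⟩ : ∃ c, c = form e f₀ * form f f₀ := ⟨_, rfl⟩
  -- Removing the components of `f₀` along `e` and `f` leaves norm `-2c`; adding `c e'` makes it
  -- isotropic again.
  refine ⟨e, f, e', f₀ - form e f₀ • f - form f f₀ • e + c • e', E, ?_, ee', ?_, fe', ?_⟩
  · constructor <;>
    simp only [map_sub, map_add, map_smul, LinearMap.sub_apply, LinearMap.add_apply,
      LinearMap.smul_apply, smul_eq_mul, form_comm f₀ e, form_comm f₀ f, form_comm f₀ e', E.he,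
      E.pe, E.hf, E.pf, E.ee, E.ff, E.ef, E'.he, E'.pe, E'.hf, E'.pf, E'.ee, E'.ff, E'.ef, fe, ee',
      fe', e'e, e'f, hc] <;> ring
  all_goals
    simp only [map_sub, map_add, map_smul, smul_eq_mul, E.ee, E.ff, E.ef, fe, ee', fe']
    ring

end IsElevenPair

/-! ### Eichler's criterion. -/

lemma form_eq_zero_of_mem_span {h p e x : I222} (he : form h e = 0) (pe : form p e = 0)
    (hx : x ∈ Submodule.span ℤ {h, p}) : form e x = 0 := by
  obtain ⟨a, b, rfl⟩ := Submodule.mem_span_pair.1 hx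
  simp [-zsmul_eq_mul, form_comm e, he, pe]

lemma exists_pos_lt_of_not_dvd {a r : ℤ} (ha : 0 < a) (h : ¬ a ∣ r) :
    ∃ k : ℤ, 0 < a - (r - k * a) ∧ a - (r - k * a) < a := by
  refine ⟨r / a, ?_⟩
  have h1 := Int.emod_def r a
  have h2 := Int.emod_nonneg r ha.ne'
  have h3 := Int.emod_lt_of_pos r ha
  have h4 : r % a ≠ 0 := fun h0 => h (Int.dvd_of_emod_eq_zero h0)
  rw [mul_comm (r / a) a, ← h1]
  omega

namespace IsElevenPair

variable {h p : I222} (H : IsElevenPair h p)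
include H

lemma exists_transvection {e a : I222} (he : form h e = 0) (pe : form p e = 0)
    (ee : form e e = 0) (ha : form h a = 0) (pa : form p a = 0) (ea : form e a = 0) :
    ∃ m, form a a = 2 * m ∧ ∃ g ∈ isometriesFixing (Submodule.span ℤ {h, p}),
      ∀ x, g x = x - form a x • e + form e x • a - (m * form e x) • e := by
  obtain ⟨m, hm⟩ := H.even a ha pa
  rw [← two_mul] at hm
  exact ⟨m, hm, I222.exists_transvection ee ea hm
    (fun x hx => form_eq_zero_of_mem_span he pe hx)
    (fun x hx => form_eq_zero_of_mem_span ha pa hx)⟩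

/-- A vector whose pairing with `⟨h, p⟩^⊥` is onto `ℤ` can be moved to a vector whose product
with `e` is `1`. -/
lemma exists_pairing_eq_one {e f e' f' : I222} (E : IsHyperbolicPair h p e f)
    (E' : IsHyperbolicPair h p e' f') (ee' : form e e' = 0) (ef' : form e f' = 0)
    (fe' : form f e' = 0) (ff' : form f f' = 0) {u y : I222} (hy : form h y = 0)
    (py : form p y = 0) (uy : form y u = 1) :
    ∃ g ∈ isometriesFixing (Submodule.span ℤ {h, p}), form e (g u) = 1 := by
  have fe : form f e = 1 := by rw [form_comm, E.ef]
  have f'e' : form f' e' = 1 := by rw [form_comm, E'.ef]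
  have e'e : form e' e = 0 := by rw [form_comm, ee']
  have f'e : form f' e = 0 := by rw [form_comm, ef']
  have e'f : form e' f = 0 := by rw [form_comm, fe']
  have f'f : form f' f = 0 := by rw [form_comm, ff']
  set G := isometriesFixing (Submodule.span ℤ {h, p}) with hG
  let O : Set I222 := {x | ∃ g ∈ G, g u = x}
  have move {a b : I222} (ha : form h a = 0) (pa : form p a = 0) (aa : form a a = 0)
      (hb : form h b = 0) (pb : form p b = 0) (ab : form a b = 0) {x : I222} (hx : x ∈ O) :
      ∃ m, form b b = 2 * m ∧ x - form b x • a + form a x • b - (m * form a x) • a ∈ O := by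
    obtain ⟨m, hm, g, hg, hgx⟩ := H.exists_transvection ha pa aa hb pb ab
    obtain ⟨g', hg', rfl⟩ := hx
    exact ⟨m, hm, g * g', G.mul_mem hg hg', by rw [LinearEquiv.mul_apply, hgx]⟩
  have move₁ (k : ℤ) {x : I222} (hx : x ∈ O) : ∃ x' ∈ O, form e x' = form e x - k * form e' x := by
    obtain ⟨m, hm, h1⟩ := move E.hf E.pf E.ff (b := k • e') (by simp [-zsmul_eq_mul, E'.he])
      (by simp [-zsmul_eq_mul, E'.pe]) (by simp [-zsmul_eq_mul, fe']) hx
    simp [-zsmul_eq_mul, E'.ee] at hm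
    refine ⟨_, h1, ?_⟩
    simp [-zsmul_eq_mul, ee', E.ef, hm]
  have move₂ (k : ℤ) {x : I222} (hx : x ∈ O) : ∃ x' ∈ O, form e x' = form e x - k * form f' x := by
    obtain ⟨m, hm, h1⟩ := move E.hf E.pf E.ff (b := k • f') (by simp [-zsmul_eq_mul, E'.hf])
      (by simp [-zsmul_eq_mul, E'.pf]) (by simp [-zsmul_eq_mul, ff']) hx
    simp [-zsmul_eq_mul, E'.ff] at hm
    refine ⟨_, h1, ?_⟩
    simp [-zsmul_eq_mul, ef', E.ef, hm]
  have move₃ (k : ℤ) {x : I222} (hx : x ∈ O) : ∃ x' ∈ O, form e x' = form e x ∧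
      form e' x' = form e' x - k * form e x := by
    obtain ⟨m, hm, h1⟩ := move E'.hf E'.pf E'.ff (b := k • e) (by simp [-zsmul_eq_mul, E.he])
      (by simp [-zsmul_eq_mul, E.pe]) (by simp [-zsmul_eq_mul, f'e]) hx
    simp [-zsmul_eq_mul, E.ee] at hm
    refine ⟨_, h1, ?_, ?_⟩
    · simp [-zsmul_eq_mul, ef', E.ee, hm]
    · simp [-zsmul_eq_mul, E'.ef, e'e, hm]
  have move₄ (k : ℤ) {x : I222} (hx : x ∈ O) : ∃ x' ∈ O, form e x' = form e x ∧
      form f' x' = form f' x - k * form e x := by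
    obtain ⟨m, hm, h1⟩ := move E'.he E'.pe E'.ee (b := k • e) (by simp [-zsmul_eq_mul, E.he])
      (by simp [-zsmul_eq_mul, E.pe]) (by simp [-zsmul_eq_mul, e'e]) hx
    simp [-zsmul_eq_mul, E.ee] at hm
    refine ⟨_, h1, ?_, ?_⟩
    · simp [-zsmul_eq_mul, ee', E.ee, hm]
    · simp [-zsmul_eq_mul, f'e', f'e, hm]
  have move₅ {x l : I222} (hx : x ∈ O) (x0 : form e' x = 0) (hl : form h l = 0)
      (pl : form p l = 0) (l0 : form e' l = 0) : ∃ x' ∈ O, form e x' = form e x ∧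
      form f' x' = form f' x - form l x := by
    obtain ⟨m, hm, h1⟩ := move E'.he E'.pe E'.ee hl pl l0 hx
    refine ⟨_, h1, ?_, ?_⟩
    · simp [-zsmul_eq_mul, ee', x0]
    · simp [-zsmul_eq_mul, f'e', x0]
  -- The vector paired to 1 with `x` is split into a part `l` orthogonal to `e'` and a multiple of
  -- `f'`, so that `move₅` applies to `l`.
  have unimod {x : I222} (hx : x ∈ O) : ∃ l s, form h l = 0 ∧ form p l = 0 ∧ form e' l = 0 ∧
      form l x + s * form f' x = 1 := by
    obtain ⟨g, hg, rfl⟩ := hx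
    have hgh : g h = h := hg.2 h (Submodule.subset_span (by simp))
    have hgp : g p = p := hg.2 p (Submodule.subset_span (by simp))
    have h1 : form h (g y) = 0 := by rw [← hy, ← hg.1 h y, hgh]
    have h2 : form p (g y) = 0 := by rw [← py, ← hg.1 p y, hgp]
    have h3 : form (g y) (g u) = 1 := by rw [hg.1, uy]
    refine ⟨g y - form e' (g y) • f', form e' (g y), ?_, ?_, ?_, ?_⟩ <;>
    simp [-zsmul_eq_mul, h1, h2, h3, E'.hf, E'.pf, E'.ef]
  have hu : u ∈ O := ⟨1, G.one_mem, rfl⟩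
  -- If `e·x` were never positive on the orbit, the shifts by arbitrary multiples would force `e'·x
  -- = f'·x = 0` throughout it, contradicting `unimod` through `move₅`.
  have hpos : ∃ n : ℕ, 0 < n ∧ ∃ x ∈ O, form e x = n := by
    by_contra! hcon
    have hle {x : I222} (hx : x ∈ O) : form e x ≤ 0 := by
      by_contra! hlt
      exact hcon (form e x).toNat (by omega) x hx (by omega)
    have hr {a r : ℤ} (har : ∀ k : ℤ, a - k * r ≤ 0) : r = 0 := by
      by_contra hr
      have h1 := har 0
      have h2 := har (-(1 - a) * r)
      have h3 : 0 < r * r := mul_self_pos.2 hr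
      nlinarith [mul_nonneg (by linarith : 0 ≤ 1 - a) (by omega : 0 ≤ r * r - 1)]
    have he'0 {x : I222} (hx : x ∈ O) : form e' x = 0 := hr fun k => by
      obtain ⟨x', hx', h1⟩ := move₁ k hx
      rw [← h1]; exact hle hx'
    have hf'0 {x : I222} (hx : x ∈ O) : form f' x = 0 := hr fun k => by
      obtain ⟨x', hx', h1⟩ := move₂ k hx
      rw [← h1]; exact hle hx'
    obtain ⟨l, s, hl, pl, el, hls⟩ := unimod hu
    obtain ⟨x', hx', -, h1⟩ := move₅ hu (he'0 hu) hl pl el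
    rw [hf'0 hu, hf'0 hx'] at *
    omega
  classical
  obtain ⟨hn, x, hx, hxn⟩ := Nat.find_spec hpos
  set n := Nat.find hpos
  have hmin {x : I222} (hx : x ∈ O) (h0 : 0 < form e x) (hlt : form e x < n) : False :=
    Nat.find_min hpos (m := (form e x).toNat) (by omega) ⟨by omega, x, hx, by omega⟩
  have hn0 : (0 : ℤ) < n := by exact_mod_cast hn
  -- Descent: with `n` the least positive value of `e·x` on the orbit, reducing `e'·x` mod `n` and
  -- subtracting a nonzero remainder from `n` would give a smaller positive value.
  have dvd₁ {x : I222} (hx : x ∈ O) (hxn : form e x = n) : (n : ℤ) ∣ form e' x := by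
    by_contra hnd
    obtain ⟨k, hk0, hk1⟩ := exists_pos_lt_of_not_dvd hn0 hnd
    obtain ⟨x₁, hx₁, h1, h2⟩ := move₃ k hx
    obtain ⟨x₂, hx₂, h3⟩ := move₁ 1 hx₁
    rw [h1, h2, one_mul, hxn] at h3
    exact hmin hx₂ (by rw [h3]; exact hk0) (by rw [h3]; exact hk1)
  have dvd₂ {x : I222} (hx : x ∈ O) (hxn : form e x = n) : (n : ℤ) ∣ form f' x := by
    by_contra hnd
    obtain ⟨k, hk0, hk1⟩ := exists_pos_lt_of_not_dvd hn0 hnd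
    obtain ⟨x₁, hx₁, h1, h2⟩ := move₄ k hx
    obtain ⟨x₂, hx₂, h3⟩ := move₂ 1 hx₁
    rw [h1, h2, one_mul, hxn] at h3
    exact hmin hx₂ (by rw [h3]; exact hk0) (by rw [h3]; exact hk1)
  obtain ⟨c, hc⟩ := dvd₁ hx hxn
  obtain ⟨x₁, hx₁, h1, h2⟩ := move₃ c hx
  rw [hxn] at h1
  have h20 : form e' x₁ = 0 := by rw [h2, hc, hxn]; ring
  obtain ⟨l, s, hl, pl, el, hls⟩ := unimod hx₁
  obtain ⟨x₂, hx₂, h3, h4⟩ := move₅ hx₁ h20 hl pl el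
  -- Both `f'·x₁` and `f'·x₂ = f'·x₁ - l·x₁` are multiples of `n`, so `n` divides each term of
  -- `hls`.
  have h5 : (n : ℤ) ∣ 1 := by
    have h6 := dvd₂ hx₁ h1
    have h7 := dvd₂ hx₂ (h3.trans h1)
    rw [h4] at h7
    rw [← hls]
    exact dvd_add ((dvd_sub_right h6).1 h7) (h6.mul_left _)
  have h6 : (n : ℤ) = 1 := Int.eq_one_of_dvd_one hn0.le h5
  obtain ⟨g, hg, rfl⟩ := hx
  exact ⟨g, hg, by rw [hxn, h6]⟩

/-- Eichler's criterion. -/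
lemma exists_isometry {u y u' y' : I222} (hy : form h y = 0) (py : form p y = 0)
    (yu : form y u = 1) (hy' : form h y' = 0) (py' : form p y' = 0) (yu' : form y' u' = 1)
    (hu : form h u = form h u') (pu : form p u = form p u') (uu : form u u = form u' u') :
    ∃ g ∈ isometriesFixing (Submodule.span ℤ {h, p}), g u = u' := by
  obtain ⟨e, f, e', f', E, E', ee', ef', fe', ff'⟩ := H.exists_two_hyperbolic
  set G := isometriesFixing (Submodule.span ℤ {h, p}) with hG
  have fixes {g : I222 ≃ₗ[ℤ] I222} (hg : g ∈ G) : g h = h ∧ g p = p :=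
    ⟨hg.2 h (Submodule.subset_span (by simp)), hg.2 p (Submodule.subset_span (by simp))⟩
  obtain ⟨g, hg, h1⟩ := H.exists_pairing_eq_one E E' ee' ef' fe' ff' hy py yu
  obtain ⟨g', hg', h1'⟩ := H.exists_pairing_eq_one E E' ee' ef' fe' ff' hy' py' yu'
  have hgu : form h (g u) = form h (g' u') := by
    rw [← (fixes hg).1, hg.1, (fixes hg).1, hu, ← hg'.1 h u', (fixes hg').1]
  have pgu : form p (g u) = form p (g' u') := by
    rw [← (fixes hg).2, hg.1, (fixes hg).2, pu, ← hg'.1 p u', (fixes hg').2]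
  have ggu : form (g u) (g u) = form (g' u') (g' u') := by rw [hg.1, hg'.1, uu]
  obtain ⟨t, ht, htx⟩ : ∃ t ∈ G, t (g u) = g' u' := by
    generalize g u = v at *
    generalize g' u' = v' at *
    -- With `a = v' - v` and `e·v = 1`, equal norms give `a·a = -2 (a·v)`; the multiples of `e`
    -- cancel and `v` goes to `v + a = v'`.
    obtain ⟨m, hm, t, ht, htx⟩ := H.exists_transvection E.he E.pe E.ee (a := v' - v)
      (by rw [map_sub, hgu, sub_self]) (by rw [map_sub, pgu, sub_self])
      (by rw [map_sub, h1, h1', sub_self])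
    refine ⟨t, ht, ?_⟩
    rw [htx, h1]
    have : m = - form (v' - v) v := by
      simp only [map_sub, LinearMap.sub_apply, form_comm v' v] at hm ⊢
      linarith
    rw [this]
    module
  refine ⟨g'⁻¹ * (t * g), G.mul_mem (G.inv_mem hg') (G.mul_mem ht hg), ?_⟩
  rw [LinearEquiv.mul_apply, LinearEquiv.mul_apply, htx]
  exact g'.symm_apply_apply u'

end IsElevenPair

/-! ### Gram matrices, primitivity and bases of markings. -/

lemma linearIndependent_triple {x y z : I222}
    (H : ∀ a b c : ℤ, a • x + b • y + c • z = 0 → a = 0 ∧ b = 0 ∧ c = 0) :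
    LinearIndependent ℤ ![x, y, z] := by
  refine Fintype.linearIndependent_iff.2 fun g hg => ?_
  rw [Fin.sum_univ_three] at hg
  obtain ⟨h0, h1, h2⟩ := H _ _ _ hg
  intro i
  fin_cases i <;> assumption

namespace IsElevenPair

variable {h p : I222} (H : IsElevenPair h p)
include H

/-- Completing squares with leading minors 15 and 11; this yields positive definiteness from `d >
0`. -/
lemma mul_form_self_eq (u : I222) (a b c : ℤ) :
    165 * form (a • h + b • p + c • u) (a • h + b • p + c • u) =
      11 * (15 * a + 7 * b + form h u * c) ^ 2 +
      (11 * b + (15 * form p u - 7 * form h u) * c) ^ 2 +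
      15 * (11 * form u u -
        (4 * form h u ^ 2 - 14 * form h u * form p u + 15 * form p u ^ 2)) * c ^ 2 := by
  simp only [map_add, map_smul, LinearMap.add_apply, LinearMap.smul_apply, smul_eq_mul, H.hh,
    H.hp, H.ph, H.pp, form_comm u h, form_comm u p]
  ring

lemma eq_zero_of_form_nonpos {u : I222} {d : ℤ} (hd : 0 < d)
    (hu : 11 * form u u -
      (4 * form h u ^ 2 - 14 * form h u * form p u + 15 * form p u ^ 2) = d) {a b c : ℤ}
    (h0 : form (a • h + b • p + c • u) (a • h + b • p + c • u) ≤ 0) : a = 0 ∧ b = 0 ∧ c = 0 := by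
  have h1 := H.mul_form_self_eq u a b c
  rw [hu] at h1
  have h2 : 15 * d * c ^ 2 = 0 := le_antisymm (by
    nlinarith [sq_nonneg (15 * a + 7 * b + form h u * c),
      sq_nonneg (11 * b + (15 * form p u - 7 * form h u) * c)]) (by positivity)
  have hc : c = 0 := by
    have := (mul_eq_zero.1 h2).resolve_left (by positivity)
    exact pow_eq_zero_iff (two_ne_zero) |>.1 this
  subst hc
  have h3 : (11 * b) ^ 2 = 0 := le_antisymm (by nlinarith [sq_nonneg (15 * a + 7 * b)])
    (by positivity)
  have hb : b = 0 := by simpa using h3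
  subst hb
  have h4 : (15 * a) ^ 2 = 0 := le_antisymm (by nlinarith) (by positivity)
  exact ⟨by simpa using h4, rfl, rfl⟩

lemma linearIndependent {u : I222} {d : ℤ} (hd : 0 < d)
    (hu : 11 * form u u -
      (4 * form h u ^ 2 - 14 * form h u * form p u + 15 * form p u ^ 2) = d) :
    LinearIndependent ℤ ![h, p, u] := by
  refine linearIndependent_triple fun a b c habc => ?_
  exact H.eq_zero_of_form_nonpos hd hu (by rw [habc]; simp)

lemma hasGramMatrixExtending {u : I222} (hli : LinearIndependent ℤ ![h, p, u]) :
    HasGramMatrixExtending h p (Submodule.span ℤ {h, p, u})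
      !![15, 7, form h u; 7, 4, form p u; form h u, form p u, form u u] := by
  have hrange : Set.range ![h, p, u] = {h, p, u} := by
    rw [Matrix.range_cons, Matrix.range_cons_cons_empty, Set.singleton_union]
  rw [← hrange]
  have hb (i : Fin 3) : ((Module.Basis.span hli i : Submodule.span ℤ (Set.range ![h, p, u])) : I222)
      = ![h, p, u] i := by
    rw [Module.Basis.span_apply]
  refine ⟨Module.Basis.span hli, hb 0, hb 1, ?_⟩
  ext i j
  rw [gramMatrix, Matrix.of_apply, hb, hb]
  fin_cases i <;> fin_cases j <;>
    simp [H.hh, H.hp, H.ph, H.pp, form_comm u h, form_comm u p]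

omit H in
lemma det_extending (a b c : ℤ) : (!![15, 7, a; 7, 4, b; a, b, c] : Matrix _ _ ℤ).det =
    11 * c - (4 * a ^ 2 - 14 * a * b + 15 * b ^ 2) := by
  rw [Matrix.det_fin_three]
  simp
  ring

lemma isMarking_span {u y : I222} {d : ℤ} (hd : 0 < d)
    (hu : 11 * form u u -
      (4 * form h u ^ 2 - 14 * form h u * form p u + 15 * form p u ^ 2) = d)
    (hy : form h y = 0) (py : form p y = 0) (yu : form y u = 1) :
    IsMarking (Submodule.span ℤ {h, p}) d (Submodule.span ℤ {h, p, u}) := by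
  refine ⟨Submodule.span_mono (by simp [Set.insert_subset_iff]), fun n x hn hx => ?_,
    fun x hx hx0 => ?_, ?_⟩
  -- Pairing with `y`, `h'` and `p'` recovers the coordinates of `n • x` one after another, showing
  -- each divisible by `n`.
  · obtain ⟨h', p', hh', ph', hp', pp'⟩ := H.exists_dual
    obtain ⟨a, b, c, habc⟩ := Submodule.mem_span_triple.1 hx
    have hc : c = n * form x y := by
      have := congrArg (fun v => form v y) habc
      simpa [-zsmul_eq_mul, hy, py, form_comm u y, yu] using this
    obtain ⟨z, hz⟩ : ∃ z, z = x - form x y • u := ⟨_, rfl⟩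
    have hnz : n • z = a • h + b • p := by
      rw [hz, smul_sub, smul_smul, ← hc, ← habc]; abel
    have ha : a = n * form z h' := by
      have := congrArg (fun v => form v h') hnz
      simpa [-zsmul_eq_mul, hh', ph', eq_comm] using this
    have hb : b = n * form z p' := by
      have := congrArg (fun v => form v p') hnz
      simpa [-zsmul_eq_mul, hp', pp', eq_comm] using this
    refine Submodule.mem_span_triple.2 ⟨form z h', form z p', form x y, ?_⟩
    refine smul_right_injective _ hn ?_
    change n • _ = n • _
    rw [smul_add, smul_add, smul_smul, smul_smul, smul_smul, ← ha, ← hb, ← hc, habc]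
  · obtain ⟨a, b, c, rfl⟩ := Submodule.mem_span_triple.1 hx
    by_contra! hle
    obtain ⟨rfl, rfl, rfl⟩ := H.eq_zero_of_form_nonpos hd hu hle
    simp at hx0
  · obtain ⟨b, -, -, hb⟩ := H.hasGramMatrixExtending (H.linearIndependent hd hu)
    exact ⟨b, by rw [hb, det_extending, hu]⟩

omit H in
lemma det_gramMatrix_eq {M : Submodule ℤ I222} {r : ℕ} (b b' : Module.Basis (Fin r) ℤ M) :
    (gramMatrix b).det = (gramMatrix b').det := by
  have key (b : Module.Basis (Fin r) ℤ M) :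
      gramMatrix b = LinearMap.BilinForm.toMatrix b (form.restrict M) := by
    ext i j
    simp [gramMatrix, LinearMap.BilinForm.toMatrix_apply]
  have h1 := LinearMap.BilinForm.toMatrix_mul_basis_toMatrix b b' (form.restrict M)
  rw [← key, ← key] at h1
  have h2 : (b.toMatrix b').det * (b.toMatrix b').det = 1 := by
    have : IsUnit (b.toMatrix b').det := by
      refine IsUnit.of_mul_eq_one (b'.toMatrix b).det ?_
      rw [← Matrix.det_mul, b.toMatrix_mul_toMatrix_flip, Matrix.det_one]
    exact Int.isUnit_mul_self this
  rw [← h1, Matrix.det_mul, Matrix.det_mul, Matrix.det_transpose]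
  linear_combination (- (gramMatrix b).det) * h2

/-- Pairing with `h'` and `p'` splits `⟨h, p⟩` off `M`; the kernel has rank 1 and `u` is its
generator. -/
lemma exists_eq_span {M : Submodule ℤ I222} {d : ℤ}
    (hM : IsMarking (Submodule.span ℤ {h, p}) d M) :
    ∃ u, M = Submodule.span ℤ {h, p, u} ∧ 11 * form u u -
      (4 * form h u ^ 2 - 14 * form h u * form p u + 15 * form p u ^ 2) = d := by
  obtain ⟨h', p', hh', ph', hp', pp'⟩ := H.exists_dual
  obtain ⟨b, hb⟩ := hM.disc
  have hhM : h ∈ M := hM.le (Submodule.subset_span (by simp))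
  have hpM : p ∈ M := hM.le (Submodule.subset_span (by simp))
  let φ : M →ₗ[ℤ] ℤ × ℤ := ((form h').prod (form p')) ∘ₗ M.subtype
  have hφ (x : M) : φ x = (form x h', form x p') := by
    simp [φ, form_comm h', form_comm p']
  have hsurj : Function.Surjective φ := by
    refine fun ⟨s, t⟩ => ⟨s • ⟨h, hhM⟩ + t • ⟨p, hpM⟩, ?_⟩
    rw [hφ]
    simp [-zsmul_eq_mul, hh', ph', hp', pp']
  have hker : Module.finrank ℤ (LinearMap.ker φ) = 1 := by
    have h1 := Submodule.finrank_quotient_add_finrank (LinearMap.ker φ)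
    rw [(φ.quotKerEquivOfSurjective hsurj).finrank_eq, Module.finrank_eq_card_basis b] at h1
    simp at h1
    omega
  obtain ⟨bk⟩ := (finrank_eq_one_iff Unit).1 hker
  obtain ⟨⟨u, hu⟩, huk⟩ : ∃ u : M, u = (bk () : M) := ⟨_, rfl⟩
  have huφ : φ ⟨u, hu⟩ = 0 := by rw [huk]; exact (bk ()).2
  have uh' : form u h' = 0 := congrArg Prod.fst ((hφ _).symm.trans huφ)
  have up' : form u p' = 0 := congrArg Prod.snd ((hφ _).symm.trans huφ)
  have hu0 : u ≠ 0 := by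
    rintro rfl
    exact bk.ne_zero () (Subtype.ext huk.symm)
  have hspan : M = Submodule.span ℤ {h, p, u} := by
    refine le_antisymm (fun x hx => ?_) ?_
    · have hk : φ ⟨x - form x h' • h - form x p' • p,
          M.sub_mem (M.sub_mem hx (M.smul_mem _ hhM)) (M.smul_mem _ hpM)⟩ = 0 := by
        rw [hφ]
        simp [-zsmul_eq_mul, hh', ph', hp', pp']
      have h1 := bk.sum_repr ⟨_, hk⟩
      simp only [Finset.univ_unique, Finset.sum_singleton] at h1
      have h2 := congrArg (fun v : LinearMap.ker φ => ((v : M) : I222)) h1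
      refine Submodule.mem_span_triple.2 ⟨form x h', form x p', bk.repr ⟨_, hk⟩ (), ?_⟩
      have h3 : ((bk () : M) : I222) = u := by rw [← huk]
      change bk.repr ⟨_, hk⟩ () • ((bk () : M) : I222) = x - form x h' • h - form x p' • p at h2
      rw [h3] at h2
      rw [h2]
      abel
    · rw [Submodule.span_le]
      simp [Set.insert_subset_iff, hhM, hpM, hu]
  have hli : LinearIndependent ℤ ![h, p, u] := by
    refine linearIndependent_triple fun a b c habc => ?_
    have h1 := congrArg (fun v => form v h') habc
    have h2 := congrArg (fun v => form v p') habc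
    simp [-zsmul_eq_mul, hh', ph', hp', pp', uh', up'] at h1 h2
    subst h1 h2
    simpa [-zsmul_eq_mul, hu0] using habc
  refine ⟨u, hspan, ?_⟩
  subst hspan
  obtain ⟨b', -, -, hb'⟩ := H.hasGramMatrixExtending hli
  rw [← hb, det_gramMatrix_eq b b', hb', det_extending]

end IsElevenPair

/-! ### Normal forms and the single orbit. -/

lemma span_triple_le {h p u v : I222} {ε i j : ℤ} (hv : v = ε • u + i • h + j • p) :
    Submodule.span ℤ {h, p, v} ≤ Submodule.span ℤ {h, p, u} := by
  rw [Submodule.span_le]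
  rintro x (rfl | rfl | rfl)
  · exact Submodule.subset_span (by simp)
  · exact Submodule.subset_span (by simp)
  · exact Submodule.mem_span_triple.2 ⟨i, j, ε, by rw [hv]; abel⟩

lemma exists_sign {a b c a₀ b₀ c₀ : ℤ}
    (hd : 11 * c - (4 * a ^ 2 - 14 * a * b + 15 * b ^ 2) =
      11 * c₀ - (4 * a₀ ^ 2 - 14 * a₀ * b₀ + 15 * b₀ ^ 2)) :
    ∃ ε i j : ℤ, ε * ε = 1 ∧ ε * a + 15 * i + 7 * j = a₀ ∧ ε * b + 7 * i + 4 * j = b₀ := by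
  suffices ∃ ε : ℤ, ε * ε = 1 ∧ (11 : ℤ) ∣ 4 * (a₀ - ε * a) - 7 * (b₀ - ε * b) by
    obtain ⟨ε, hε, k, hk⟩ := this
    -- These are the solutions of the system with matrix `[[15, 7], [7, 4]]`, by Cramer's rule.
    refine ⟨ε, k, 2 * (b₀ - ε * b) - (a₀ - ε * a) + k, hε, ?_, ?_⟩
    all_goals generalize ε * a = A at *; generalize ε * b = B at *; omega
  have h1 : (11 : ℤ) ∣ ((4 * a₀ - 7 * b₀) - (4 * a - 7 * b)) *
      ((4 * a₀ - 7 * b₀) + (4 * a - 7 * b)) :=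
    ⟨4 * (c₀ - c) - (b₀ ^ 2 - b ^ 2), by linear_combination 4 * hd⟩
  rcases prime_eleven.dvd_or_dvd h1 with h2 | h2
  · exact ⟨1, by norm_num, by
      rwa [show 4 * (a₀ - 1 * a) - 7 * (b₀ - 1 * b) = 4 * a₀ - 7 * b₀ - (4 * a - 7 * b) by ring]⟩
  · exact ⟨-1, by norm_num, by
      rwa [show 4 * (a₀ - -1 * a) - 7 * (b₀ - -1 * b) = 4 * a₀ - 7 * b₀ + (4 * a - 7 * b) by ring]⟩

namespace IsElevenPair

variable {h p : I222} (H : IsElevenPair h p)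
include H

/-- Modulo `⟨h, p⟩`, `u` equals `m z`, with `m` the content of its pairing with the complement.
Saturation puts `z` in the marking, and comparing coefficients of `u` gives `m c = 1`. -/
lemma exists_pairing_of_isMarking {u : I222} {d : ℤ} (hd : 0 < d)
    (hu : 11 * form u u -
      (4 * form h u ^ 2 - 14 * form h u * form p u + 15 * form p u ^ 2) = d)
    (hM : IsMarking (Submodule.span ℤ {h, p}) d (Submodule.span ℤ {h, p, u})) :
    ∃ y, form h y = 0 ∧ form p y = 0 ∧ form y u = 1 := by
  obtain ⟨h', p', hh', ph', hp', pp'⟩ := H.exists_dual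
  obtain ⟨m, z, y, hz, hy, py, uy⟩ := exists_content_orthogonal hh' ph' hp' pp' u
  have hind {a b c : ℤ} (h0 : a • h + b • p + c • u = 0) : c = 0 :=
    (H.eq_zero_of_form_nonpos hd hu (a := a) (b := b) (c := c) (by rw [h0]; simp)).2.2
  have hm : m ≠ 0 := by
    rintro rfl
    have := hind (a := - form u h') (b := - form u p') (c := 1) (by
      rw [zero_smul] at hz
      rw [← hz]
      module)
    omega
  have hzM := hM.primitive m z hm (by
    rw [← hz]
    exact Submodule.mem_span_triple.2 ⟨- form u h', - form u p', 1, by module⟩)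
  obtain ⟨a, b, c, rfl⟩ := Submodule.mem_span_triple.1 hzM
  have h1 : 1 - m * c = 0 := hind (a := - form u h' - m * a) (b := - form u p' - m * b) (by
    rw [← sub_eq_zero] at hz
    rw [← hz]
    module)
  refine ⟨c • y, by simp [-zsmul_eq_mul, hy], by simp [-zsmul_eq_mul, py], ?_⟩
  rw [map_smul, LinearMap.smul_apply, smul_eq_mul, form_comm, uy]
  linarith

lemma exists_normalized {M : Submodule ℤ I222} {d a₀ b₀ c₀ : ℤ} (hd : 0 < d)
    (h₀ : 11 * c₀ - (4 * a₀ ^ 2 - 14 * a₀ * b₀ + 15 * b₀ ^ 2) = d)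
    (hM : IsMarking (Submodule.span ℤ {h, p}) d M) :
    ∃ u y, M = Submodule.span ℤ {h, p, u} ∧ form h u = a₀ ∧ form p u = b₀ ∧ form u u = c₀ ∧
      form h y = 0 ∧ form p y = 0 ∧ form y u = 1 := by
  obtain ⟨u, rfl, hu⟩ := H.exists_eq_span hM
  obtain ⟨ε, i, j, hε, ha, hb⟩ := exists_sign (hu.trans h₀.symm)
  obtain ⟨v, hv⟩ : ∃ v, v = ε • u + i • h + j • p := ⟨_, rfl⟩
  have hspan : Submodule.span ℤ {h, p, u} = Submodule.span ℤ {h, p, v} := by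
    refine le_antisymm (span_triple_le (ε := ε) (i := -(ε * i)) (j := -(ε * j)) ?_)
      (span_triple_le hv)
    rw [hv]
    match_scalars <;> first | ring1 | linear_combination -hε
  have hhv : form h v = a₀ := by
    rw [← ha, hv]
    simp only [map_add, map_smul, smul_eq_mul, H.hh, H.hp]; ring
  have hpv : form p v = b₀ := by
    rw [← hb, hv]
    simp only [map_add, map_smul, smul_eq_mul, H.ph, H.pp]; ring
  have hvd : 11 * form v v - (4 * form h v ^ 2 - 14 * form h v * form p v + 15 * form p v ^ 2)
      = d := by
    rw [← hu, hv]
    simp only [map_add, map_smul, LinearMap.add_apply, LinearMap.smul_apply, smul_eq_mul, H.hh,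
      H.hp, H.ph, H.pp, form_comm u h, form_comm u p]
    linear_combination (11 * form u u -
      (4 * form h u ^ 2 - 14 * form h u * form p u + 15 * form p u ^ 2)) * hε
  have hvv : form v v = c₀ := by
    rw [hhv, hpv] at hvd
    linarith
  rw [hspan] at hM ⊢
  obtain ⟨y, hy, py, yv⟩ := H.exists_pairing_of_isMarking hd hvd hM
  exact ⟨v, y, rfl, hhv, hpv, hvv, hy, py, yv⟩

lemma exists_vector {a₀ b₀ c₀ : ℤ} (hc : Even (c₀ - b₀)) :
    ∃ u y, form h u = a₀ ∧ form p u = b₀ ∧ form u u = c₀ ∧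
      form h y = 0 ∧ form p y = 0 ∧ form y u = 1 := by
  obtain ⟨h', p', hh', ph', hp', pp'⟩ := H.exists_dual
  obtain ⟨e, f, -, -, E, -⟩ := H.exists_two_hyperbolic
  have fe : form f e = 1 := by rw [form_comm, E.ef]
  obtain ⟨w, hw, pw, ew, fw⟩ : ∃ w, form h w = a₀ ∧ form p w = b₀ ∧ form e w = 0 ∧
      form f w = 0 := by
    obtain ⟨v, hv, pv⟩ : ∃ v, form h v = a₀ ∧ form p v = b₀ := by
      refine ⟨a₀ • h' + b₀ • p', ?_, ?_⟩ <;> simp [-zsmul_eq_mul, hh', ph', hp', pp']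
    refine ⟨v - form f v • e - form e v • f, ?_, ?_, ?_, ?_⟩ <;>
    simp [-zsmul_eq_mul, hv, pv, E.he, E.pe, E.hf, E.pf, E.ee, E.ef, E.ff, fe]
  obtain ⟨k, hk⟩ : Even (c₀ - form w w) := by
    have := hc.sub (H.even_form_sub w)
    rwa [pw, sub_sub_sub_cancel_right] at this
  -- With `w` orthogonal to `e` and `f`, adding `e + k f` raises the norm by `2k` and makes the
  -- product with `f` equal to 1.
  refine ⟨w + e + k • f, f, ?_, ?_, ?_, E.hf, E.pf, ?_⟩
  · simp [-zsmul_eq_mul, hw, E.he, E.hf]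
  · simp [-zsmul_eq_mul, pw, E.pe, E.pf]
  · simp only [map_add, map_smul, LinearMap.add_apply, LinearMap.smul_apply, smul_eq_mul,
      form_comm w e, form_comm w f, ew, fw, E.ee, E.ef, E.ff, fe]
    linarith
  · simp [-zsmul_eq_mul, fw, fe, E.ff]

/-- Markings with a given Gram matrix exist, and all markings of the same discriminant lie in one
orbit. -/
theorem exists_marking {d a₀ b₀ c₀ : ℤ} (hd : 0 < d)
    (h₀ : 11 * c₀ - (4 * a₀ ^ 2 - 14 * a₀ * b₀ + 15 * b₀ ^ 2) = d) (hc : Even (c₀ - b₀)) :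
    ∃ M : markings (Submodule.span ℤ {h, p}) d,
      (∀ o : MarkingOrbits (Submodule.span ℤ {h, p}) d, o = Quotient.mk _ M) ∧
      HasGramMatrixExtending h p M !![15, 7, a₀; 7, 4, b₀; a₀, b₀, c₀] := by
  obtain ⟨u, y, hu, pu, uu, hy, py, yu⟩ := H.exists_vector (a₀ := a₀) hc
  have hud : 11 * form u u -
      (4 * form h u ^ 2 - 14 * form h u * form p u + 15 * form p u ^ 2) = d := by
    rw [hu, pu, uu, h₀]
  refine ⟨⟨_, H.isMarking_span hd hud hy py yu⟩, fun o => ?_, ?_⟩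
  · induction o using Quotient.inductionOn with
    | h N =>
      obtain ⟨N, hN⟩ := N
      obtain ⟨v, z, rfl, hv, pv, vv, hz, pz, zv⟩ := H.exists_normalized hd h₀ hN
      obtain ⟨g, hg, hgu⟩ := H.exists_isometry hy py yu hz pz zv (hu.trans hv.symm)
        (pu.trans pv.symm) (uu.trans vv.symm)
      refine Quotient.sound ⟨⟨g, hg⟩, Subtype.ext ?_⟩
      change Submodule.map (g : I222 →ₗ[ℤ] I222) (Submodule.span ℤ {h, p, u}) = _
      have hgh : g h = h := hg.2 h (Submodule.subset_span (by simp))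
      have hgp : g p = p := hg.2 p (Submodule.subset_span (by simp))
      rw [Submodule.map_span]
      simp [Set.image_insert_eq, hgh, hgp, hgu]
  · have := H.hasGramMatrixExtending (H.linearIndependent hd hud)
    rwa [hu, pu, uu] at this

end IsElevenPair

end I222

theorem proposition2
    -- `h` and `p` span the sublattice `Λ₁₁` with Gram matrix `[[15, 7], [7, 4]]`
    (h p : I222) (L : Submodule ℤ I222) (hL : L = Submodule.span ℤ {h, p})
    (hh : I222.form h h = 15) (hp : I222.form h p = 7) (pp : I222.form p p = 4)
    -- its orthogonal complement `Λ_van` is an even lattice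
    (heven : ∀ x ∈ I222.form.orthogonal L, Even (I222.form x x))
    (d : ℤ) (hd : 0 < d)
    (hmod : d ≡ 0 [ZMOD 22] ∨ d ≡ 2 [ZMOD 22] ∨ d ≡ 6 [ZMOD 22] ∨
      d ≡ 8 [ZMOD 22] ∨ d ≡ 10 [ZMOD 22] ∨ d ≡ 18 [ZMOD 22]) :
    ∃ M : markings L d,
      (∀ o : MarkingOrbits L d, o = Quotient.mk _ M) ∧
      -- all the divisions by 11 below are exact
      (d ≡ 0 [ZMOD 22] →
        HasGramMatrixExtending h p M !![15, 7, 0; 7, 4, 0; 0, 0, d / 11]) ∧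
      (d ≡ 2 [ZMOD 22] →
        HasGramMatrixExtending h p M !![15, 7, 3; 7, 4, 1; 3, 1, (d + 9) / 11]) ∧
      (d ≡ 6 [ZMOD 22] →
        HasGramMatrixExtending h p M !![15, 7, 1; 7, 4, 1; 1, 1, (d + 5) / 11]) ∧
      (d ≡ 8 [ZMOD 22] →
        HasGramMatrixExtending h p M !![15, 7, 2; 7, 4, 1; 2, 1, (d + 3) / 11]) ∧
      (d ≡ 10 [ZMOD 22] →
        HasGramMatrixExtending h p M !![15, 7, 3; 7, 4, 2; 3, 2, (d + 12) / 11]) ∧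
      (d ≡ 18 [ZMOD 22] →
        HasGramMatrixExtending h p M !![15, 7, 1; 7, 4, 0; 1, 0, (d + 4) / 11]) := by
  subst hL
  have H : I222.IsElevenPair h p := ⟨hh, hp, pp, fun x hx px => heven x fun y hy => by
    change I222.form y x = 0
    rw [I222.form_comm]
    exact I222.form_eq_zero_of_mem_span hx px hy⟩
  simp only [Int.ModEq] at *
  rcases hmod with h1 | h1 | h1 | h1 | h1 | h1
  · obtain ⟨M, hM, hG⟩ := H.exists_marking (a₀ := 0) (b₀ := 0) (c₀ := d / 11) hd (by omega)
      (by rw [Int.even_iff]; omega)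
    exact ⟨M, hM, by simp [h1, hG]⟩
  · obtain ⟨M, hM, hG⟩ := H.exists_marking (a₀ := 3) (b₀ := 1) (c₀ := (d + 9) / 11) hd (by omega)
      (by rw [Int.even_iff]; omega)
    exact ⟨M, hM, by simp [h1, hG]⟩
  · obtain ⟨M, hM, hG⟩ := H.exists_marking (a₀ := 1) (b₀ := 1) (c₀ := (d + 5) / 11) hd (by omega)
      (by rw [Int.even_iff]; omega)
    exact ⟨M, hM, by simp [h1, hG]⟩
  · obtain ⟨M, hM, hG⟩ := H.exists_marking (a₀ := 2) (b₀ := 1) (c₀ := (d + 3) / 11) hd (by omega)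
      (by rw [Int.even_iff]; omega)
    exact ⟨M, hM, by simp [h1, hG]⟩
  · obtain ⟨M, hM, hG⟩ := H.exists_marking (a₀ := 3) (b₀ := 2) (c₀ := (d + 12) / 11) hd (by omega)
      (by rw [Int.even_iff]; omega)
    exact ⟨M, hM, by simp [h1, hG]⟩
  · obtain ⟨M, hM, hG⟩ := H.exists_marking (a₀ := 1) (b₀ := 0) (c₀ := (d + 4) / 11) hd (by omega)
      (by rw [Int.even_iff]; omega)
    exact ⟨M, hM, by simp [h1, hG]⟩
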